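/- Let $\lambda_a,\lambda_u>0$ and let $\Phi_a$ be a homogeneous Poisson point process on $\mathbb R^2$ of density $\lambda_a$ (the access points). Let $X^*$ be the point of $\Phi_a$ nearest to the origin $o$, and let $$\mathcal V^*=\{y\in\mathbb R^2: |y-X^*|<|y-z| \text{ for all } z\in\Phi_a\setminus\{X^*\}\}$$ be its Voronoi cell. For $x^*\in\mathbb R^2\setminus\{o\}$ and $x\in\mathbb R^2$ let $$p_c(x\mid x^*)=\mathbb P(x\in\mathcal V^*\mid X^*=x^*):=\lim_{\varepsilon\downarrow0}\mathbb P\bigl(x\in\mathcal V^*\,\big|\,|X^*-x^*|<\varepsilon\bigr),$$ and define the equivalent density of interfering user equipments seen by a receiver at the origin as $$\lambda_{o,u}(r)=\lambda_u\Bigl(1-\frac1{2\pi}\int_0^{2\pi}p_c\bigl((r\cos\theta,r\sin\theta)\mid x^*\bigr)\,d\theta\Bigr),\qquad r\ge0 .$$ Then, for every $x^*\neq o$, the limit defining $p_c(x\mid x^*)$ exists for every $x$, the integrand above is integrable for every $r\ge0$, and $$\lambda_{o,u}(r)=\lambda_u\lambda_a\,\frac{8}{\pi}\,|x^*|\,r+O(r^2)\qquad(r\to0^+).$$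 In particular $\lambda_{o,u}(r)/r\to\lambda_u\lambda_a\frac8\pi|x^*|$ as $r\to0^+$: the density vanishes only linearly, at a rate proportional to $|x^*|$. -/

import Mathlib

open MeasureTheory ProbabilityTheory Filter Topology Asymptotics
open scoped NNReal

noncomputable section

/-- The Euclidean plane `ℝ²`; its origin is the position `o` of the typical node. -/
abbrev Plane : Type := EuclideanSpace ℝ (Fin 2)

/-- `Φ` is a homogeneous Poisson point process on the plane of density `lam`, seen as a random
locally finite set: numbers of points in bounded Borel sets are random variables, Poisson
distributed with mean `lam` times the area, and independent over disjoint sets. -/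
structure IsHomogeneousPPP {Ω : Type*} [MeasurableSpace Ω] (P : Measure Ω)
    (Φ : Ω → Set Plane) (lam : ℝ≥0) : Prop where
  locallyFinite : ∀ ω, ∀ B : Set Plane, Bornology.IsBounded B → (Φ ω ∩ B).Finite
  measurable_count : ∀ B : Set Plane, MeasurableSet B → Bornology.IsBounded B →
    Measurable (fun ω => (Φ ω ∩ B).ncard)
  hasLaw_count : ∀ B : Set Plane, MeasurableSet B → Bornology.IsBounded B →
    HasLaw (fun ω => (Φ ω ∩ B).ncard) (poissonMeasure (lam * (volume B).toNNReal)) P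
  indep_count : ∀ (n : ℕ) (B : Fin n → Set Plane), (∀ i, MeasurableSet (B i)) →
    (∀ i, Bornology.IsBounded (B i)) → Pairwise (fun i j => Disjoint (B i) (B j)) →
    iIndepFun (fun i ω => (Φ ω ∩ B i).ncard) P

/-- `c` is a point of the configuration `S` at minimal distance from the origin. -/
def IsNearestPoint (S : Set Plane) (c : Plane) : Prop :=
  c ∈ S ∧ ∀ z ∈ S, ‖c‖ ≤ ‖z‖

/-- The (open) Voronoi cell of the point `c` in the configuration `S`. -/
def voronoiCell (S : Set Plane) (c : Plane) : Set Plane :=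
  {y | ∀ z ∈ S \ {c}, ‖y - c‖ < ‖y - z‖}

/-- The elementary conditional probability that `x` lies in the Voronoi cell of the nearest
access point `X`, given that `X` lies within distance `ε` of the position `xs`. -/
def approxCellProb {Ω : Type*} [MeasurableSpace Ω] (P : Measure Ω) (Φ : Ω → Set Plane)
    (X : Ω → Plane) (xs x : Plane) (ε : ℝ) : ℝ :=
  (ProbabilityTheory.cond P (X ⁻¹' Metric.ball xs ε)).real {ω | x ∈ voronoiCell (Φ ω) (X ω)}

/-- The probabilistic cell area function `p_c(x ∣ xs)`: the conditional probability that `x` lies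
in the Voronoi cell of the nearest access point `X`, given `X = xs`. The conditioning event has
probability zero, so the conditional probability is taken as the limit over shrinking discs
around `xs`. -/
def cellProb {Ω : Type*} [MeasurableSpace Ω] (P : Measure Ω) (Φ : Ω → Set Plane)
    (X : Ω → Plane) (xs x : Plane) : ℝ :=
  limUnder (𝓝[>] (0 : ℝ)) (approxCellProb P Φ X xs x)

/-- The point with polar coordinates `(r, θ)`. -/
def polarPoint (r θ : ℝ) : Plane := !₂[r * Real.cos θ, r * Real.sin θ]

/-- The equivalent density at distance `r` from a receiver at `xR` of the interfering user
equipments (a process of density `lamU`), when the nearest access point is at `xs`. -/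
def equivalentDensity {Ω : Type*} [MeasurableSpace Ω] (P : Measure Ω) (Φ : Ω → Set Plane)
    (X : Ω → Plane) (lamU : ℝ) (xs xR : Plane) (r : ℝ) : ℝ :=
  lamU * (1 - 1 / (2 * Real.pi) *
    ∫ θ in (0 : ℝ)..(2 * Real.pi), cellProb P Φ X xs (polarPoint r θ + xR))

end

/-! Given that the nearest point sits at `xs`, the disc about the origin through `xs` contains no
other point, and `x` belongs to the cell of `xs` when the disc about `x` through `xs` contains no
other point either. Only the lune, the second disc minus the first, is a new constraint, so the
conditional probability is `exp (-(lam * luneArea xs x))`. `tendsto_approxCellProb` justifies this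
for the shrinking-disc limit by enclosing the events between Poisson void events with radii changed
by `ε`.

Let `x` and `xs` have polar coordinates `(r, θ)` and `(R, β)`. In direction `α` the squared outer
radius of the lune exceeds `R²` by the positive part of `2Rr(cos(θ-α) - cos(θ-β))`, up to `O(r²)`.
Polar integration gives the lune area uniformly in `θ` (`abs_luneArea_sub_le`). Integrating the
positive part of the cosine difference over both angles gives 16
(`integral_integral_max_cos_sub_cos`). With `1 - exp (-t) = t + O(t²)`, the averaged slope is `16 /
(2π) = 8 / π` times `lam * R`. -/

/-! ### Void and single-point events of a Poisson process. -/

section PoissonCounts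

variable {Ω : Type*} [MeasurableSpace Ω] {P : Measure Ω} {Φ : Ω → Set Plane} {lam : ℝ≥0}

lemma IsHomogeneousPPP.ncard_eq_zero_iff (hΦ : IsHomogeneousPPP P Φ lam) {B : Set Plane}
    (hb : Bornology.IsBounded B) (ω : Ω) : (Φ ω ∩ B).ncard = 0 ↔ ∀ z ∈ Φ ω, z ∉ B := by
  rw [Set.ncard_eq_zero (hΦ.locallyFinite ω B hb), ← Set.disjoint_iff_inter_eq_empty,
    Set.disjoint_left]

lemma IsHomogeneousPPP.measureReal_ncard_eq (hΦ : IsHomogeneousPPP P Φ lam) {B : Set Plane}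
    (hB : MeasurableSet B) (hb : Bornology.IsBounded B) (n : ℕ) :
    P.real {ω | (Φ ω ∩ B).ncard = n} =
      Real.exp (-(lam * volume.real B)) * (lam * volume.real B) ^ n / n.factorial := by
  have h := (hΦ.hasLaw_count B hB hb).measureReal_eq (p := fun k => k = n) (by simp)
  rw [h, Set.ofPred_eq_eq_singleton, poissonMeasure_real_singleton]
  rfl

lemma IsHomogeneousPPP.measureReal_ncard_inter (hΦ : IsHomogeneousPPP P Φ lam) {B C : Set Plane}
    (hB : MeasurableSet B) (hb : Bornology.IsBounded B) (hC : MeasurableSet C)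
    (hc : Bornology.IsBounded C) (hBC : Disjoint B C) (s t : Set ℕ) :
    P.real ({ω | (Φ ω ∩ B).ncard ∈ s} ∩ {ω | (Φ ω ∩ C).ncard ∈ t}) =
      P.real {ω | (Φ ω ∩ B).ncard ∈ s} * P.real {ω | (Φ ω ∩ C).ncard ∈ t} := by
  have h := hΦ.indep_count 2 ![B, C] (by simp [Fin.forall_fin_two, hB, hC])
    (by simp [Fin.forall_fin_two, hb, hc]) (by
      intro i j hij
      fin_cases i <;> fin_cases j <;> simp_all [disjoint_comm])
  have h2 := (h.indepFun (i := 0) (j := 1) (by simp)).measure_inter_preimage_eq_mul s t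
    (by measurability) (by measurability)
  have h3 := congrArg ENNReal.toReal h2
  rw [ENNReal.toReal_mul] at h3
  exact h3

lemma IsHomogeneousPPP.measureReal_ncard_ne_zero [IsProbabilityMeasure P]
    (hΦ : IsHomogeneousPPP P Φ lam) {B : Set Plane}
    (hB : MeasurableSet B) (hb : Bornology.IsBounded B) :
    P.real {ω | (Φ ω ∩ B).ncard ≠ 0} = 1 - Real.exp (-(lam * volume.real B)) := by
  have h := hΦ.measureReal_ncard_eq hB hb 0
  have hm : MeasurableSet {ω | (Φ ω ∩ B).ncard = 0} :=
    hΦ.measurable_count B hB hb (measurableSet_singleton 0)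
  have h2 := probReal_compl_eq_one_sub (μ := P) hm
  rw [h] at h2
  simp only [pow_zero, mul_one, Nat.factorial_zero, Nat.cast_one, div_one] at h2
  exact h2

/-- An event forcing a point in `B` and no point in the disjoint region `G` is at most as likely
as these two independent count events together. -/
lemma IsHomogeneousPPP.measureReal_le_of_void [IsProbabilityMeasure P]
    (hΦ : IsHomogeneousPPP P Φ lam) {B G : Set Plane} (hB : MeasurableSet B)
    (hb : Bornology.IsBounded B) (hG : MeasurableSet G) (hg : Bornology.IsBounded G)
    (hBG : Disjoint B G) {T : Set Ω}
    (hT : ∀ᵐ ω ∂P, ω ∈ T → (∃ z ∈ Φ ω, z ∈ B) ∧ ∀ z ∈ Φ ω, z ∉ G) :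
    P.real T ≤ (1 - Real.exp (-(lam * volume.real B))) * Real.exp (-(lam * volume.real G)) := by
  have h0 := hΦ.measureReal_ncard_eq hG hg 0
  have h1 := hΦ.measureReal_ncard_inter hB hb hG hg hBG {0}ᶜ {0}
  have h2 := hΦ.measureReal_ncard_ne_zero hB hb
  simp only [Set.mem_compl_iff, Set.mem_singleton_iff] at h1
  simp only [ne_eq, pow_zero, mul_one, Nat.factorial_zero, Nat.cast_one, div_one] at h2 h0
  rw [← h2, ← h0, ← h1]
  refine ENNReal.toReal_mono (measure_ne_top _ _) (measure_mono_ae ?_)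
  filter_upwards [hT] with ω h hω
  obtain ⟨⟨z, hz, hzB⟩, h'⟩ := h hω
  exact ⟨fun h0 => (hΦ.ncard_eq_zero_iff hb ω).1 h0 z hz hzB, (hΦ.ncard_eq_zero_iff hg ω).2 h'⟩

/-- An event implied by a single point in `B` and no point in `G` outside `B` is at least as likely
as these two independent count events together. -/
lemma IsHomogeneousPPP.le_measureReal_of_void [IsProbabilityMeasure P]
    (hΦ : IsHomogeneousPPP P Φ lam) {B G : Set Plane} (hB : MeasurableSet B)
    (hb : Bornology.IsBounded B) (hG : MeasurableSet G) (hg : Bornology.IsBounded G) {T : Set Ω}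
    (hT : ∀ᵐ ω ∂P, (∃ z, Φ ω ∩ B = {z}) → (∀ z ∈ Φ ω, z ∈ G → z ∈ B) → ω ∈ T) :
    lam * volume.real B * Real.exp (-(lam * volume.real B)) * Real.exp (-(lam * volume.real G))
      ≤ P.real T := by
  -- `B` may meet `G`, so independence is applied to `G \ B`; using the larger area of `G` only
  -- weakens the lower bound.
  have hg' : Bornology.IsBounded (G \ B) := hg.subset Set.sdiff_subset
  have h0 := hΦ.measureReal_ncard_eq (hG.diff hB) hg' 0
  have h2 := hΦ.measureReal_ncard_eq hB hb 1
  have h1 := hΦ.measureReal_ncard_inter hB hb (hG.diff hB) hg' Set.disjoint_sdiff_right {1} {0}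
  simp only [Set.mem_singleton_iff] at h1
  simp only [pow_zero, pow_one, mul_one, Nat.factorial_zero, Nat.factorial_one, Nat.cast_one,
    div_one] at h2 h0
  have hv : volume.real (G \ B) ≤ volume.real G :=
    measureReal_mono Set.sdiff_subset hg.measure_lt_top.ne
  calc _ ≤ Real.exp (-(lam * volume.real B)) * (lam * volume.real B) *
        Real.exp (-(lam * volume.real (G \ B))) := by
        rw [mul_comm (Real.exp _) (_ * _)]; gcongr
    _ = _ := by rw [← h2, ← h0, ← h1]
    _ ≤ _ := by
        refine ENNReal.toReal_mono (measure_ne_top _ _) (measure_mono_ae ?_)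
        filter_upwards [hT] with ω h hω
        refine h (Set.ncard_eq_one.1 hω.1) fun z hz hzG => ?_
        by_contra hzB
        exact (hΦ.ncard_eq_zero_iff hg' ω).1 hω.2 z hz ⟨hzG, hzB⟩

end PoissonCounts

/-! ### The conditional cell probability as the exponential of a lune area. -/

section CellProbability

/-- The area of the union of two discs. -/
noncomputable def unionArea (x : Plane) (s t : ℝ) : ℝ :=
  volume.real (Metric.closedBall (0 : Plane) s ∪ Metric.closedBall x t)

lemma measureReal_closedBall_plane (x : Plane) (r : ℝ) :
    volume.real (Metric.closedBall x r) = Real.pi * (max r 0) ^ 2 := by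
  rw [measureReal_def, EuclideanSpace.volume_closedBall_fin_two]
  simp [ENNReal.toReal_ofReal', mul_comm, Real.pi_pos.le]

lemma measureReal_ball_plane (x : Plane) (r : ℝ) :
    volume.real (Metric.ball x r) = Real.pi * (max r 0) ^ 2 := by
  rw [measureReal_def, EuclideanSpace.volume_ball_fin_two]
  simp [ENNReal.toReal_ofReal', mul_comm, Real.pi_pos.le]

lemma isBounded_union_closedBall (x : Plane) (s t : ℝ) :
    Bornology.IsBounded (Metric.closedBall (0 : Plane) s ∪ Metric.closedBall x t) :=
  Metric.isBounded_closedBall.union Metric.isBounded_closedBall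

lemma unionArea_mono {x : Plane} {s s' t t' : ℝ} (hs : s ≤ s') (ht : t ≤ t') :
    unionArea x s t ≤ unionArea x s' t' :=
  measureReal_mono (Set.union_subset_union (Metric.closedBall_subset_closedBall hs)
    (Metric.closedBall_subset_closedBall ht)) (isBounded_union_closedBall x s' t').measure_lt_top.ne

/-- The added region is covered by the two annuli. This modulus of continuity drives both one-sided
limits below. -/
lemma unionArea_sub_le {x : Plane} {s s' t t' : ℝ} (hs : s ≤ s') (ht : t ≤ t') :
    unionArea x s' t' - unionArea x s t ≤
      Real.pi * ((max s' 0) ^ 2 - (max s 0) ^ 2) + Real.pi * ((max t' 0) ^ 2 - (max t 0) ^ 2) := by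
  have h1 : ∀ (y : Plane) {a b : ℝ}, a ≤ b →
      volume.real (Metric.closedBall y b \ Metric.closedBall y a) =
        Real.pi * ((max b 0) ^ 2 - (max a 0) ^ 2) := by
    intro y a b hab
    rw [measureReal_sdiff (Metric.closedBall_subset_closedBall hab)
      Metric.isClosed_closedBall.measurableSet Metric.isBounded_closedBall.measure_lt_top.ne, measureReal_closedBall_plane,
      measureReal_closedBall_plane]
    ring
  rw [← h1 0 hs, ← h1 x ht, sub_le_iff_le_add]
  refine (measureReal_mono (s₂ := ((Metric.closedBall 0 s' \ Metric.closedBall 0 s) ∪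
    (Metric.closedBall x t' \ Metric.closedBall x t)) ∪
      (Metric.closedBall (0 : Plane) s ∪ Metric.closedBall x t)) ?_ ?_).trans ?_
  · intro z hz
    simp only [Set.mem_union, Set.mem_sdiff] at hz ⊢
    tauto
  · exact (((Metric.isBounded_closedBall.subset Set.sdiff_subset).union
      (Metric.isBounded_closedBall.subset Set.sdiff_subset)).union
        (isBounded_union_closedBall x s t)).measure_lt_top.ne
  · refine (measureReal_union_le _ _).trans ?_
    unfold unionArea
    gcongr
    exact measureReal_union_le _ _

lemma tendsto_unionArea_add (x : Plane) (s t : ℝ) :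
    Tendsto (fun ε => unionArea x (s + ε) (t + ε)) (𝓝[>] 0) (𝓝 (unionArea x s t)) := by
  have h : Tendsto (fun ε : ℝ => unionArea x s t +
      (Real.pi * ((max (s + ε) 0) ^ 2 - (max s 0) ^ 2) +
        Real.pi * ((max (t + ε) 0) ^ 2 - (max t 0) ^ 2))) (𝓝[>] 0) (𝓝 (unionArea x s t)) := by
    refine tendsto_nhdsWithin_of_tendsto_nhds ?_
    refine Continuous.tendsto' (by fun_prop) _ _ (by simp)
  refine tendsto_of_tendsto_of_tendsto_of_le_of_le' tendsto_const_nhds h ?_ ?_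
  · filter_upwards [self_mem_nhdsWithin] with ε (hε : 0 < ε)
    exact unionArea_mono (by linarith) (by linarith)
  · filter_upwards [self_mem_nhdsWithin] with ε (hε : 0 < ε)
    have := unionArea_sub_le (x := x) (s := s) (s' := s + ε) (t := t) (t' := t + ε)
      (by linarith) (by linarith)
    linarith

lemma tendsto_unionArea_sub (x : Plane) (s t : ℝ) :
    Tendsto (fun ε => unionArea x (s - ε) (t - ε)) (𝓝[>] 0) (𝓝 (unionArea x s t)) := by
  have h : Tendsto (fun ε : ℝ => unionArea x s t -
      (Real.pi * ((max s 0) ^ 2 - (max (s - ε) 0) ^ 2) +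
        Real.pi * ((max t 0) ^ 2 - (max (t - ε) 0) ^ 2))) (𝓝[>] 0) (𝓝 (unionArea x s t)) := by
    refine tendsto_nhdsWithin_of_tendsto_nhds ?_
    refine Continuous.tendsto' (by fun_prop) _ _ (by simp)
  refine tendsto_of_tendsto_of_tendsto_of_le_of_le' h tendsto_const_nhds ?_ ?_
  · filter_upwards [self_mem_nhdsWithin] with ε (hε : 0 < ε)
    have := unionArea_sub_le (x := x) (s := s - ε) (s' := s) (t := t - ε) (t' := t)
      (by linarith) (by linarith)
    linarith
  · filter_upwards [self_mem_nhdsWithin] with ε (hε : 0 < ε)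
    exact unionArea_mono (by linarith) (by linarith)

lemma unionArea_zero (s : ℝ) : unionArea 0 s s = volume.real (Metric.closedBall (0 : Plane) s) := by
  simp [unionArea]

variable {Ω : Type*} [MeasurableSpace Ω] {P : Measure Ω} {Φ : Ω → Set Plane}
  {lam : ℝ≥0} {X : Ω → Plane}

lemma approxCellProb_eq (hXmeas : Measurable X) (xs x : Plane) (ε : ℝ) :
    approxCellProb P Φ X xs x ε = P.real (X ⁻¹' Metric.ball xs ε ∩
      {ω | x ∈ voronoiCell (Φ ω) (X ω)}) / P.real (X ⁻¹' Metric.ball xs ε) := by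
  rw [approxCellProb, measureReal_def, cond_apply (hXmeas measurableSet_ball), ENNReal.toReal_mul,
    ENNReal.toReal_inv, div_eq_inv_mul]
  rfl

variable [IsProbabilityMeasure P]

/-- Shrinking both radii by `ε` makes the discs disjoint from the ball around `xs`, and, by the
triangle inequality, still void on the event. -/
lemma measureReal_nearest_inter_cell_le (hΦ : IsHomogeneousPPP P Φ lam)
    (hX : ∀ᵐ ω ∂P, IsNearestPoint (Φ ω) (X ω)) (xs x : Plane) (ε : ℝ) :
    P.real (X ⁻¹' Metric.ball xs ε ∩ {ω | x ∈ voronoiCell (Φ ω) (X ω)}) ≤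
      (1 - Real.exp (-(lam * volume.real (Metric.ball xs ε)))) *
        Real.exp (-(lam * unionArea x (‖xs‖ - ε) (‖x - xs‖ - ε))) := by
  refine hΦ.measureReal_le_of_void measurableSet_ball Metric.isBounded_ball
    (Metric.isClosed_closedBall.measurableSet.union Metric.isClosed_closedBall.measurableSet)
    (isBounded_union_closedBall _ _ _) ?_ ?_
  · rw [Set.disjoint_left]
    rintro z hz (h | h)
    · rw [mem_ball_iff_norm] at hz
      rw [mem_closedBall_zero_iff] at h
      have := norm_sub_norm_le xs z
      rw [norm_sub_rev] at this
      linarith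
    · rw [mem_ball_iff_norm] at hz
      rw [mem_closedBall_iff_norm, norm_sub_rev] at h
      have := norm_sub_le_norm_sub_add_norm_sub x z xs
      linarith
  · filter_upwards [hX] with ω hω hT
    obtain ⟨h1, h2⟩ := hT
    have h3 : ‖X ω - xs‖ < ε := mem_ball_iff_norm.1 h1
    refine ⟨⟨X ω, hω.1, h1⟩, ?_⟩
    rintro z hz (h | h)
    · rw [mem_closedBall_zero_iff] at h
      have := norm_sub_norm_le xs (X ω)
      rw [norm_sub_rev] at this
      have := hω.2 z hz
      linarith
    · rw [mem_closedBall_iff_norm, norm_sub_rev] at h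
      have h4 := norm_sub_le_norm_sub_add_norm_sub x (X ω) xs
      rcases eq_or_ne z (X ω) with rfl | hne
      · linarith
      · have := h2 z ⟨hz, hne⟩
        linarith

lemma measureReal_nearest_le (hΦ : IsHomogeneousPPP P Φ lam)
    (hX : ∀ᵐ ω ∂P, IsNearestPoint (Φ ω) (X ω)) (xs : Plane) (ε : ℝ) :
    P.real (X ⁻¹' Metric.ball xs ε) ≤
      (1 - Real.exp (-(lam * volume.real (Metric.ball xs ε)))) *
        Real.exp (-(lam * unionArea 0 (‖xs‖ - ε) (‖xs‖ - ε))) := by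
  rw [unionArea_zero]
  refine hΦ.measureReal_le_of_void measurableSet_ball Metric.isBounded_ball
    Metric.isClosed_closedBall.measurableSet Metric.isBounded_closedBall ?_ ?_
  · rw [Set.disjoint_left]
    intro z hz h
    rw [mem_ball_iff_norm] at hz
    rw [mem_closedBall_zero_iff] at h
    have := norm_sub_norm_le xs z
    rw [norm_sub_rev] at this
    linarith
  · filter_upwards [hX] with ω hω h1
    have h3 : ‖X ω - xs‖ < ε := mem_ball_iff_norm.1 h1
    refine ⟨⟨X ω, hω.1, h1⟩, ?_⟩
    intro z hz h
    rw [mem_closedBall_zero_iff] at h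
    have := norm_sub_norm_le xs (X ω)
    rw [norm_sub_rev] at this
    have := hω.2 z hz
    linarith

/-- If the ball holds a single point and the discs enlarged by `ε` hold none outside it, that point
must be `X`, and every other point is farther from `x`. -/
lemma le_measureReal_nearest_inter_cell (hΦ : IsHomogeneousPPP P Φ lam)
    (hX : ∀ᵐ ω ∂P, IsNearestPoint (Φ ω) (X ω)) (xs x : Plane) (ε : ℝ) :
    lam * volume.real (Metric.ball xs ε) * Real.exp (-(lam * volume.real (Metric.ball xs ε))) *
        Real.exp (-(lam * unionArea x (‖xs‖ + ε) (‖x - xs‖ + ε))) ≤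
      P.real (X ⁻¹' Metric.ball xs ε ∩ {ω | x ∈ voronoiCell (Φ ω) (X ω)}) := by
  refine hΦ.le_measureReal_of_void measurableSet_ball Metric.isBounded_ball
    (Metric.isClosed_closedBall.measurableSet.union Metric.isClosed_closedBall.measurableSet)
    (isBounded_union_closedBall _ _ _) ?_
  filter_upwards [hX] with ω hω ⟨z0, hz0⟩ hG
  have hz0' : z0 ∈ Φ ω ∩ Metric.ball xs ε := hz0 ▸ Set.mem_singleton z0
  have h0 := hz0'.2
  rw [mem_ball_iff_norm] at h0
  have hXB : X ω ∈ Metric.ball xs ε := by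
    refine hG _ hω.1 (Or.inl ?_)
    rw [mem_closedBall_zero_iff]
    have h1 := hω.2 z0 hz0'.1
    have h2 := norm_sub_norm_le z0 xs
    linarith
  refine ⟨hXB, fun z hz => ?_⟩
  have hXz : X ω = z0 := by
    have : X ω ∈ ({z0} : Set Plane) := hz0 ▸ ⟨hω.1, hXB⟩
    exact this
  have hzB : z ∉ Metric.ball xs ε := fun h => by
    have : z ∈ ({z0} : Set Plane) := hz0 ▸ ⟨hz.1, h⟩
    exact hz.2 (by rw [hXz]; exact this)
  have hzG := mt (fun h => hG z hz.1 (Or.inr h)) hzB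
  rw [mem_closedBall_iff_norm, not_le, norm_sub_rev z] at hzG
  have h4 := norm_sub_le_norm_sub_add_norm_sub x xs (X ω)
  rw [norm_sub_rev xs, hXz] at h4
  rw [hXz]
  linarith

/-- For a small Poisson mean, "at least one point" and "exactly one point" are asymptotically
equally likely, so the prefactors of the upper and lower bounds cancel in the limit. -/
lemma tendsto_exp_sub_one_div : Tendsto (fun m : ℝ => (1 - Real.exp (-m)) / (m * Real.exp (-m)))
    (𝓝[>] 0) (𝓝 1) := by
  have h := (hasDerivAt_iff_tendsto_slope.1 (Real.hasDerivAt_exp 0))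
  rw [Real.exp_zero] at h
  refine (h.mono_left (nhdsWithin_mono _ fun m hm => ne_of_gt hm)).congr' ?_
  filter_upwards [self_mem_nhdsWithin] with m (hm : 0 < m)
  have hm' := hm.ne'
  rw [slope_def_field, Real.exp_zero, Real.exp_neg, sub_zero]
  field_simp

/-- The area of the part of the disc around `x` through `xs` that lies outside the disc around
the origin through `xs`. -/
noncomputable def luneArea (xs x : Plane) : ℝ :=
  volume.real (Metric.closedBall x ‖x - xs‖ \ Metric.closedBall 0 ‖xs‖)

lemma luneArea_eq (xs x : Plane) :
    luneArea xs x = unionArea x ‖xs‖ ‖x - xs‖ - unionArea 0 ‖xs‖ ‖xs‖ := by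
  rw [unionArea_zero, luneArea, unionArea, ← Set.union_sdiff_self,
    measureReal_union Set.disjoint_sdiff_right (Metric.isClosed_closedBall.measurableSet.diff
      Metric.isClosed_closedBall.measurableSet) Metric.isBounded_closedBall.measure_lt_top.ne
      (Metric.isBounded_closedBall.subset Set.sdiff_subset).measure_lt_top.ne]
  ring

theorem tendsto_approxCellProb (hlam : 0 < lam) (hΦ : IsHomogeneousPPP P Φ lam)
    (hXmeas : Measurable X) (hX : ∀ᵐ ω ∂P, IsNearestPoint (Φ ω) (X ω)) (xs x : Plane) :
    Tendsto (approxCellProb P Φ X xs x) (𝓝[>] (0 : ℝ))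
      (𝓝 (Real.exp (-(lam * luneArea xs x)))) := by
  set m : ℝ → ℝ := fun ε => lam * volume.real (Metric.ball xs ε) with hm
  have hmpos : ∀ ε > 0, 0 < m ε := fun ε hε => by
    have : (0 : ℝ) < max ε 0 := lt_max_of_lt_left hε
    have hl : (0 : ℝ) < lam := hlam
    simp only [hm, measureReal_ball_plane]
    have := Real.pi_pos
    positivity
  have hm0 : Tendsto m (𝓝[>] 0) (𝓝[>] 0) := by
    refine tendsto_nhdsWithin_iff.2 ⟨tendsto_nhdsWithin_of_tendsto_nhds ?_, ?_⟩
    · simp only [hm, measureReal_ball_plane]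
      exact Continuous.tendsto' (by fun_prop) _ _ (by simp)
    · filter_upwards [self_mem_nhdsWithin] with ε hε using hmpos ε hε
  have hq := tendsto_exp_sub_one_div.comp hm0
  have hexp : Real.exp (-(lam * luneArea xs x)) =
      Real.exp (-(lam * unionArea x ‖xs‖ ‖x - xs‖)) /
        Real.exp (-(lam * unionArea 0 ‖xs‖ ‖xs‖)) := by
    rw [← Real.exp_sub, luneArea_eq]; congr 1; ring
  have hcont : ∀ {f : ℝ → ℝ} {a : ℝ}, Tendsto f (𝓝[>] 0) (𝓝 a) →
      Tendsto (fun ε => Real.exp (-(lam * f ε))) (𝓝[>] 0) (𝓝 (Real.exp (-(lam * a)))) :=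
    fun h => (Real.continuous_exp.tendsto _).comp (h.const_mul _).neg
  have hup := hq.mul ((hcont (tendsto_unionArea_sub x ‖xs‖ ‖x - xs‖)).div
    (hcont (tendsto_unionArea_add 0 ‖xs‖ ‖xs‖)) (Real.exp_ne_zero _))
  have hlow := (hq.inv₀ one_ne_zero).mul ((hcont (tendsto_unionArea_add x ‖xs‖ ‖x - xs‖)).div
    (hcont (tendsto_unionArea_sub 0 ‖xs‖ ‖xs‖)) (Real.exp_ne_zero _))
  rw [one_mul, ← hexp] at hup
  rw [inv_one, one_mul, ← hexp] at hlow
  refine tendsto_of_tendsto_of_tendsto_of_le_of_le' hlow hup ?_ ?_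
  · filter_upwards [self_mem_nhdsWithin] with ε (hε : 0 < ε)
    have hme := hmpos ε hε
    have he : 0 < 1 - Real.exp (-m ε) := by simpa using hme
    have hA : 0 < P.real (X ⁻¹' Metric.ball xs ε) := by
      -- At `x = 0` the two discs coincide, so the joint lower bound also bounds the conditioning
      -- event from below.
      refine lt_of_lt_of_le ?_ ((le_measureReal_nearest_inter_cell hΦ hX xs 0 ε).trans
        (measureReal_mono Set.inter_subset_left))
      positivity
    rw [approxCellProb_eq hXmeas]
    simp only [Function.comp_apply, inv_div, Pi.div_apply, div_mul_div_comm]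
    exact div_le_div₀ measureReal_nonneg (le_measureReal_nearest_inter_cell hΦ hX xs x ε) hA
      (measureReal_nearest_le hΦ hX xs ε)
  · filter_upwards [self_mem_nhdsWithin] with ε (hε : 0 < ε)
    have hme := hmpos ε hε
    have he : 0 < 1 - Real.exp (-m ε) := by simpa using hme
    rw [approxCellProb_eq hXmeas]
    simp only [Function.comp_apply, Pi.div_apply, div_mul_div_comm]
    refine div_le_div₀ (by positivity) (measureReal_nearest_inter_cell_le hΦ hX xs x ε)
      (by positivity) ?_
    have := (le_measureReal_nearest_inter_cell hΦ hX xs 0 ε).trans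
        (measureReal_mono Set.inter_subset_left)
    simpa using this

theorem cellProb_eq (hlam : 0 < lam) (hΦ : IsHomogeneousPPP P Φ lam)
    (hXmeas : Measurable X) (hX : ∀ᵐ ω ∂P, IsNearestPoint (Φ ω) (X ω)) (xs x : Plane) :
    cellProb P Φ X xs x = Real.exp (-(lam * luneArea xs x)) :=
  (tendsto_approxCellProb hlam hΦ hXmeas hX xs x).limUnder_eq

lemma measurable_luneArea (xs : Plane) : Measurable (luneArea xs) := by
  -- The lunes are the sections of one measurable set in the product.
  have h : MeasurableSet {p : Plane × Plane | ‖p.2 - p.1‖ ≤ ‖p.1 - xs‖ ∧ ¬ ‖p.2‖ ≤ ‖xs‖} := by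
    refine MeasurableSet.inter (measurableSet_le (f := fun p : Plane × Plane => ‖p.2 - p.1‖)
      (g := fun p => ‖p.1 - xs‖) (by fun_prop) (by fun_prop))
      (measurableSet_le (f := fun p : Plane × Plane => ‖p.2‖) (g := fun _ => ‖xs‖) (by fun_prop)
        (by fun_prop)).compl
  convert! (measurable_measure_prodMk_left (ν := (volume : Measure Plane)) h).ennreal_toReal using 2
    with x
  rw [luneArea, measureReal_def]
  congr 2
  ext z
  simp [dist_eq_norm]

lemma luneArea_nonneg (xs x : Plane) : 0 ≤ luneArea xs x := measureReal_nonneg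

end CellProbability

/-! ### First-order expansion of the lune area in polar coordinates. -/

section PolarArea

lemma norm_polarPoint {ρ : ℝ} (hρ : 0 ≤ ρ) (α : ℝ) : ‖polarPoint ρ α‖ = ρ := by
  rw [EuclideanSpace.norm_eq, Real.sqrt_eq_iff_eq_sq (by positivity) hρ]
  simp only [polarPoint, Fin.sum_univ_two, Real.norm_eq_abs, sq_abs]
  simp
  linear_combination ρ ^ 2 * Real.sin_sq_add_cos_sq α

lemma norm_polarPoint_sub_sq (ρ α r θ : ℝ) :
    ‖polarPoint ρ α - polarPoint r θ‖ ^ 2 = ρ ^ 2 + r ^ 2 - 2 * ρ * r * Real.cos (θ - α) := by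
  rw [EuclideanSpace.norm_eq, Real.sq_sqrt (by positivity)]
  simp only [polarPoint, Fin.sum_univ_two, Real.norm_eq_abs, sq_abs]
  simp
  rw [Real.cos_sub]
  linear_combination ρ ^ 2 * Real.sin_sq_add_cos_sq α + r ^ 2 * Real.sin_sq_add_cos_sq θ

lemma exists_polarPoint_eq (z : Plane) : ∃ β, polarPoint ‖z‖ β = z := by
  refine ⟨Complex.arg ⟨z 0, z 1⟩, ?_⟩
  have h : ‖z‖ = ‖(⟨z 0, z 1⟩ : ℂ)‖ := by
    rw [EuclideanSpace.norm_eq, Complex.norm_def, Complex.normSq_mk]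
    simp [Fin.sum_univ_two, sq]
  ext i
  fin_cases i
  · simp [polarPoint, h, Complex.norm_mul_cos_arg]
  · simp [polarPoint, h, Complex.norm_mul_sin_arg]

lemma continuous_polarPoint : Continuous fun p : ℝ × ℝ => polarPoint p.1 p.2 := by
  unfold polarPoint
  refine (PiLp.continuous_toLp 2 _).comp (continuous_pi fun i => ?_)
  fin_cases i <;> simp <;> fun_prop

/-- Areas in the plane computed in polar coordinates. -/
lemma volume_eq_lintegral_polarPoint {S : Set Plane} (hS : MeasurableSet S) :
    volume S = ∫⁻ α in Set.Ioo (-Real.pi) Real.pi, ∫⁻ ρ in Set.Ioi (0 : ℝ),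
      ENNReal.ofReal ρ * S.indicator 1 (polarPoint ρ α) := by
  have hmp := (PiLp.volume_preserving_toLp (Fin 2)).comp
    (volume_preserving_finTwoArrow ℝ).symm
  have h1 : volume S = ∫⁻ p : ℝ × ℝ, S.indicator (1 : Plane → ENNReal) !₂[p.1, p.2] := by
    rw [← lintegral_indicator_one hS, ← hmp.lintegral_comp (measurable_one.indicator hS)]
    rfl
  rw [h1, ← lintegral_comp_polarCoord_symm, polarCoord_target, Measure.volume_eq_prod,
    ← Measure.prod_restrict, lintegral_prod_symm]
  · rfl
  · refine Measurable.aemeasurable ?_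
    have : Measurable fun p : ℝ × ℝ => S.indicator (1 : Plane → ENNReal) (polarPoint p.1 p.2) :=
      (measurable_one.indicator hS).comp continuous_polarPoint.measurable
    exact (ENNReal.measurable_ofReal.comp measurable_fst).mul this

/-- Since `ρ dρ = d(ρ²)/2`, measuring the excess in squared radius makes each ray's contribution
linear in `h`. -/
lemma lintegral_annulus_sector {R h : ℝ} (hR : 0 ≤ R) (hh : 0 ≤ h) :
    ∫⁻ ρ in Set.Ioi (0 : ℝ), ENNReal.ofReal ρ *
      {ρ : ℝ | R < ρ ∧ ρ ^ 2 ≤ R ^ 2 + h}.indicator 1 ρ = ENNReal.ofReal (h / 2) := by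
  set T := Real.sqrt (R ^ 2 + h) with hT
  have hT0 : 0 ≤ T := Real.sqrt_nonneg _
  have hT2 : T ^ 2 = R ^ 2 + h := Real.sq_sqrt (by positivity)
  have hRT : R ≤ T := Real.le_sqrt_of_sq_le (by linarith)
  have hset : {ρ : ℝ | R < ρ ∧ ρ ^ 2 ≤ R ^ 2 + h} = Set.Ioc R T := by
    ext ρ
    simp only [Set.mem_ofPred_eq, Set.mem_Ioc, and_congr_right_iff]
    intro hρ
    rw [← hT2, sq_le_sq₀ (by linarith) hT0]
  rw [hset]
  have h1 : ∀ ρ : ℝ, ENNReal.ofReal ρ * (Set.Ioc R T).indicator 1 ρ =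
      (Set.Ioc R T).indicator (fun ρ => ENNReal.ofReal ρ) ρ := by
    intro ρ
    by_cases h : ρ ∈ Set.Ioc R T <;> simp [h]
  simp_rw [h1]
  rw [setLIntegral_indicator measurableSet_Ioc, Set.inter_eq_left.2
    (show Set.Ioc R T ⊆ Set.Ioi 0 from fun ρ hρ => lt_of_le_of_lt hR hρ.1), ← ofReal_integral_eq_lintegral_ofReal,
    ← intervalIntegral.integral_of_le hRT, integral_id]
  · congr 1; linarith
  · exact (continuous_id.integrableOn_Icc).mono_set Set.Ioc_subset_Icc_self
  · filter_upwards [ae_restrict_mem measurableSet_Ioc] with ρ hρ using hR.trans hρ.1.le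

lemma lintegral_Ioo_ofReal {h : ℝ → ℝ} (hc : Continuous h) (h0 : ∀ α, 0 ≤ h α) :
    ∫⁻ α in Set.Ioo (-Real.pi) Real.pi, ENNReal.ofReal (h α / 2) =
      ENNReal.ofReal (∫ α in (-Real.pi)..Real.pi, h α / 2) := by
  rw [intervalIntegral.integral_of_le (by linarith [Real.pi_pos]), integral_Ioc_eq_integral_Ioo,
    ofReal_integral_eq_lintegral_ofReal]
  · exact ((hc.div_const 2).integrableOn_Icc).mono_set Set.Ioo_subset_Icc_self
  · exact Eventually.of_forall fun α => div_nonneg (h0 α) zero_le_two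

lemma volume_real_le_of_polar {S : Set Plane} (hS : MeasurableSet S) {R : ℝ} (hR : 0 ≤ R)
    {h : ℝ → ℝ} (hc : Continuous h) (h0 : ∀ α, 0 ≤ h α)
    (hsub : ∀ ρ α, 0 < ρ → polarPoint ρ α ∈ S → R < ρ ∧ ρ ^ 2 ≤ R ^ 2 + h α) :
    volume.real S ≤ ∫ α in (-Real.pi)..Real.pi, h α / 2 := by
  refine ENNReal.toReal_le_of_le_ofReal (intervalIntegral.integral_nonneg
    (by linarith [Real.pi_pos]) fun α _ => div_nonneg (h0 α) zero_le_two) ?_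
  rw [volume_eq_lintegral_polarPoint hS, ← lintegral_Ioo_ofReal hc h0]
  refine lintegral_mono fun α => ?_
  rw [← lintegral_annulus_sector hR (h0 α)]
  refine setLIntegral_mono' measurableSet_Ioi fun ρ hρ => ?_
  gcongr
  by_cases hm : polarPoint ρ α ∈ S
  · have := hsub ρ α hρ hm
    simp [hm, this]
  · simp [hm]

lemma le_volume_real_of_polar {S : Set Plane} (hS : MeasurableSet S) (hSf : volume S ≠ ⊤)
    {R : ℝ} (hR : 0 ≤ R) {h : ℝ → ℝ} (hc : Continuous h) (h0 : ∀ α, 0 ≤ h α)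
    (hsub : ∀ ρ α, 0 < ρ → R < ρ → ρ ^ 2 ≤ R ^ 2 + h α → polarPoint ρ α ∈ S) :
    ∫ α in (-Real.pi)..Real.pi, h α / 2 ≤ volume.real S := by
  refine (ENNReal.ofReal_le_iff_le_toReal hSf).1 ?_
  rw [volume_eq_lintegral_polarPoint hS, ← lintegral_Ioo_ofReal hc h0]
  refine lintegral_mono fun α => ?_
  rw [← lintegral_annulus_sector hR (h0 α)]
  refine setLIntegral_mono' measurableSet_Ioi fun ρ hρ => ?_
  gcongr
  by_cases hm : R < ρ ∧ ρ ^ 2 ≤ R ^ 2 + h α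
  · have := hsub ρ α hρ hm.1 hm.2
    simp [hm, this]
  · simp [hm]

lemma mem_lune_polarPoint_iff {R r ρ : ℝ} (hR : 0 ≤ R) (hρ : 0 ≤ ρ) (β θ α : ℝ) :
    polarPoint ρ α ∈ Metric.closedBall (polarPoint r θ) ‖polarPoint r θ - polarPoint R β‖ \
      Metric.closedBall 0 ‖polarPoint R β‖ ↔
    R < ρ ∧ ρ ^ 2 - 2 * ρ * r * Real.cos (θ - α) ≤ R ^ 2 - 2 * R * r * Real.cos (θ - β) := by
  rw [Set.mem_sdiff, mem_closedBall_zero_iff, norm_polarPoint hR, norm_polarPoint hρ, not_le,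
    mem_closedBall_iff_norm, norm_sub_rev (polarPoint r θ), and_comm,
    ← sq_le_sq₀ (norm_nonneg _) (norm_nonneg _), norm_polarPoint_sub_sq, norm_polarPoint_sub_sq]
  refine and_congr_right fun _ => ?_
  constructor <;> intro h <;> linarith

/-- The hypothesis reads `ρ² - R² ≤ 2Rr(w - v) + 2r(ρ - R)w`. Together with `r ≤ R / 2` it forces `ρ
- R ≤ 4r`, so the last term is at most `8r²`. -/
lemma lune_radius_sq_le {R r ρ w v : ℝ} (hR : 0 < R) (hr : 0 ≤ r) (hrR : r ≤ R / 2) (hw : |w| ≤ 1)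
    (hv : |v| ≤ 1) (hρ : R < ρ) (h : ρ ^ 2 - 2 * ρ * r * w ≤ R ^ 2 - 2 * R * r * v) :
    ρ ^ 2 ≤ R ^ 2 + (max (2 * (R * r * (w - v))) 0 + 8 * r ^ 2) := by
  obtain ⟨hw1, hw2⟩ := abs_le.1 hw
  obtain ⟨hv1, hv2⟩ := abs_le.1 hv
  have hd : 0 < ρ - R := sub_pos.2 hρ
  have h1 : (ρ - R) * r * w ≤ (ρ - R) * r := by
    have := mul_nonneg (mul_nonneg hd.le hr) (sub_nonneg.2 hw2)
    linarith
  have h2 : (ρ - R) * (2 * R) ≤ ρ ^ 2 - R ^ 2 := by nlinarith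
  have h3 : R * r * (w - v) ≤ R * r * 2 :=
    mul_le_mul_of_nonneg_left (by linarith) (by positivity)
  have h4 : (ρ - R) * r ≤ (ρ - R) * (R / 2) := mul_le_mul_of_nonneg_left hrR hd.le
  have h5 : ρ - R ≤ 4 * r := by
    have : (ρ - R) * R ≤ (4 * r) * R := by nlinarith
    exact le_of_mul_le_mul_right this hR
  have h6 : (ρ - R) * r ≤ 4 * r * r := mul_le_mul_of_nonneg_right h5 hr
  have := le_max_left (2 * (R * r * (w - v))) 0
  nlinarith

lemma lune_of_radius_sq_le {R r ρ w v : ℝ} (hR : 0 < R) (hr : 0 ≤ r) (hw : |w| ≤ 1)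
    (hv : |v| ≤ 1) (hρ : R < ρ) (h : ρ ^ 2 ≤ R ^ 2 + max (2 * (R * r * (w - v)) - 4 * r ^ 2) 0) :
    ρ ^ 2 - 2 * ρ * r * w ≤ R ^ 2 - 2 * R * r * v := by
  obtain ⟨hw1, hw2⟩ := abs_le.1 hw
  obtain ⟨hv1, hv2⟩ := abs_le.1 hv
  have hd : 0 < ρ - R := sub_pos.2 hρ
  have h2 : (ρ - R) * (2 * R) ≤ ρ ^ 2 - R ^ 2 := by nlinarith
  have h2' : 0 < (ρ - R) * (2 * R) := by positivity
  -- The maximum cannot be 0, as `ρ > R`. The subtracted `4r²` pays for the cross term `2r(ρ - R)w`,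
  -- because `ρ - R ≤ 2r`.
  have h0 : ρ ^ 2 ≤ R ^ 2 + (2 * (R * r * (w - v)) - 4 * r ^ 2) := by
    rcases max_cases (2 * (R * r * (w - v)) - 4 * r ^ 2) 0 with h' | h'
    · rwa [h'.1] at h
    · rw [h'.1] at h; linarith
  have h1 : -((ρ - R) * r) ≤ (ρ - R) * r * w := by
    have := mul_nonneg (mul_nonneg hd.le hr) (neg_le_iff_add_nonneg.1 hw1)
    linarith
  have h3 : R * r * (w - v) ≤ R * r * 2 :=
    mul_le_mul_of_nonneg_left (by linarith) (by positivity)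
  have h5 : ρ - R ≤ 2 * r := by
    have : (ρ - R) * R ≤ (2 * r) * R := by nlinarith [sq_nonneg r]
    exact le_of_mul_le_mul_right this hR
  have h6 : (ρ - R) * r ≤ 2 * r * r := mul_le_mul_of_nonneg_right h5 hr
  nlinarith

lemma abs_luneArea_sub_le {R r : ℝ} (hR : 0 < R) (hr : 0 ≤ r) (hrR : r ≤ R / 2) (β θ : ℝ) :
    |luneArea (polarPoint R β) (polarPoint r θ) -
      R * r * ∫ α in (-Real.pi)..Real.pi, max (Real.cos (θ - α) - Real.cos (θ - β)) 0| ≤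
      8 * Real.pi * r ^ 2 := by
  set c : ℝ → ℝ := fun α => R * r * (Real.cos (θ - α) - Real.cos (θ - β)) with hc
  have hcc : Continuous c := by fun_prop
  have hRr : 0 ≤ R * r := by positivity
  have hmain : R * r * ∫ α in (-Real.pi)..Real.pi, max (Real.cos (θ - α) - Real.cos (θ - β)) 0 =
      ∫ α in (-Real.pi)..Real.pi, max (c α) 0 := by
    rw [← intervalIntegral.integral_const_mul]
    congr 1 with α
    rw [mul_max_of_nonneg _ _ hRr, mul_zero]
  have hm : MeasurableSet (Metric.closedBall (polarPoint r θ)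
      ‖polarPoint r θ - polarPoint R β‖ \ Metric.closedBall 0 ‖polarPoint R β‖) :=
    Metric.isClosed_closedBall.measurableSet.diff Metric.isClosed_closedBall.measurableSet
  have hi : IntervalIntegrable (fun α => max (c α) 0) volume (-Real.pi) Real.pi :=
    (hcc.max continuous_const).intervalIntegrable _ _
  have hup := volume_real_le_of_polar hm hR.le (h := fun α => max (2 * c α) 0 + 8 * r ^ 2)
    (by fun_prop) (fun α => by positivity) fun ρ α hρ h => by
      rw [mem_lune_polarPoint_iff hR.le hρ.le] at h
      exact ⟨h.1, lune_radius_sq_le hR hr hrR (Real.abs_cos_le_one _) (Real.abs_cos_le_one _) h.1 h.2⟩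
  have hlow := le_volume_real_of_polar hm
    (Metric.isBounded_closedBall.subset Set.sdiff_subset).measure_lt_top.ne hR.le
    (h := fun α => max (2 * c α - 4 * r ^ 2) 0) (by fun_prop) (fun α => le_max_right _ _)
    fun ρ α hρ hRρ h => by
      rw [mem_lune_polarPoint_iff hR.le hρ.le]
      exact ⟨hRρ, lune_of_radius_sq_le hR hr (Real.abs_cos_le_one _) (Real.abs_cos_le_one _) hRρ h⟩
  have h1 : ∫ α in (-Real.pi)..Real.pi, (max (2 * c α) 0 + 8 * r ^ 2) / 2 =
      (∫ α in (-Real.pi)..Real.pi, max (c α) 0) + 8 * Real.pi * r ^ 2 := by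
    have : ∀ α, (max (2 * c α) 0 + 8 * r ^ 2) / 2 = max (c α) 0 + 4 * r ^ 2 := fun α => by
      rw [← mul_zero (2 : ℝ), ← mul_max_of_nonneg _ _ zero_le_two, mul_zero]; ring
    simp_rw [this]
    rw [intervalIntegral.integral_add hi (by simp), intervalIntegral.integral_const, smul_eq_mul]
    ring
  have h2 : (∫ α in (-Real.pi)..Real.pi, max (c α) 0) - 4 * Real.pi * r ^ 2 ≤
      ∫ α in (-Real.pi)..Real.pi, max (2 * c α - 4 * r ^ 2) 0 / 2 := by
    have h3 : (∫ α in (-Real.pi)..Real.pi, max (c α) 0) - 4 * Real.pi * r ^ 2 =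
        ∫ α in (-Real.pi)..Real.pi, (max (c α) 0 - 2 * r ^ 2) := by
      rw [intervalIntegral.integral_sub hi (by simp), intervalIntegral.integral_const, smul_eq_mul]
      ring
    rw [h3]
    refine intervalIntegral.integral_mono_on (by linarith [Real.pi_pos])
      (hi.sub (by simp)) (Continuous.intervalIntegrable (by fun_prop) _ _) fun α _ => ?_
    have h4 := le_max_left (2 * c α - 4 * r ^ 2) 0
    have h5 := le_max_right (2 * c α - 4 * r ^ 2) 0
    have h6 : max (c α) 0 ≤ max (2 * c α - 4 * r ^ 2) 0 / 2 + 2 * r ^ 2 :=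
      max_le (by linarith) (by positivity)
    linarith
  rw [hmain, abs_le]
  unfold luneArea
  have hpi : 0 ≤ Real.pi * r ^ 2 := by positivity
  constructor <;> linarith

end PolarArea

/-! ### The double cosine integral that yields the constant. -/

section TrigonometricIntegral

lemma integral_abs_sin_pi : ∫ φ in (0 : ℝ)..Real.pi, |Real.sin φ| = 2 := by
  have h : ∫ φ in (0 : ℝ)..Real.pi, Real.sin φ = 2 := by
    rw [integral_sin]
    norm_num
  rw [← h]
  refine intervalIntegral.integral_congr fun φ hφ => ?_
  rw [Set.uIcc_of_le Real.pi_pos.le] at hφ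
  exact abs_of_nonneg (Real.sin_nonneg_of_mem_Icc hφ)

lemma integral_abs_sin_add (c : ℝ) :
    ∫ φ in (0 : ℝ)..(2 * Real.pi), |Real.sin (φ + c)| = 4 := by
  have hper : Function.Periodic (fun φ : ℝ => |Real.sin φ|) Real.pi := fun φ => by
    simp [Real.sin_add_pi]
  have hi : ∀ a b : ℝ, IntervalIntegrable (fun φ : ℝ => |Real.sin φ|) volume a b :=
    fun a b => Continuous.intervalIntegrable (by fun_prop) _ _
  rw [intervalIntegral.integral_comp_add_right (fun φ => |Real.sin φ|),
    ← intervalIntegral.integral_add_adjacent_intervals (hi _ (0 + c + Real.pi)) (hi _ _),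
    show 2 * Real.pi + c = 0 + c + Real.pi + Real.pi by ring,
    hper.intervalIntegral_add_eq (0 + c) 0, hper.intervalIntegral_add_eq (0 + c + Real.pi) 0,
    zero_add, integral_abs_sin_pi]
  norm_num

lemma integral_abs_sin_half : ∫ γ in (0 : ℝ)..(2 * Real.pi), |Real.sin (γ / 2)| = 4 := by
  rw [intervalIntegral.integral_comp_div (fun γ => |Real.sin γ|) two_ne_zero]
  rw [zero_div, mul_div_cancel_left₀ _ two_ne_zero, integral_abs_sin_pi]
  norm_num

/-- With `α = φ + γ`, the cosine difference becomes a product of sines. Integrating over `φ` first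
removes the phase `γ / 2`, leaving `2 · 4 · 4`. -/
lemma integral_integral_abs_cos_sub_cos :
    ∫ φ in (0 : ℝ)..(2 * Real.pi), ∫ α in (-Real.pi)..Real.pi, |Real.cos α - Real.cos φ| = 32 := by
  have h1 : ∀ φ : ℝ, ∫ α in (-Real.pi)..Real.pi, |Real.cos α - Real.cos φ| =
      ∫ γ in (0 : ℝ)..(2 * Real.pi), 2 * |Real.sin (γ / 2)| * |Real.sin (φ + γ / 2)| := by
    intro φ
    have hper : Function.Periodic (fun α : ℝ => |Real.cos α - Real.cos φ|) (2 * Real.pi) :=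
      fun α => by simp
    have h := hper.intervalIntegral_add_eq (-Real.pi) φ
    rw [show -Real.pi + 2 * Real.pi = Real.pi by ring] at h
    rw [h]
    have h' := intervalIntegral.integral_comp_add_left (a := 0) (b := 2 * Real.pi)
      (fun α : ℝ => |Real.cos α - Real.cos φ|) φ
    rw [add_zero] at h'
    rw [← h']
    refine intervalIntegral.integral_congr fun γ _ => ?_
    rw [Real.cos_sub_cos, abs_mul, abs_mul, show (φ + γ + φ) / 2 = φ + γ / 2 by ring,
      show (φ + γ - φ) / 2 = γ / 2 by ring]
    norm_num
    ring
  simp_rw [h1]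
  rw [intervalIntegral_intervalIntegral_swap]
  · simp_rw [intervalIntegral.integral_const_mul, integral_abs_sin_add,
      intervalIntegral.integral_mul_const, intervalIntegral.integral_const_mul,
      integral_abs_sin_half]
    norm_num
  · have hc : Continuous (Function.uncurry fun φ γ : ℝ =>
      2 * |Real.sin (γ / 2)| * |Real.sin (φ + γ / 2)|) := by fun_prop
    refine (hc.continuousOn.integrableOn_compact
      (isCompact_uIcc.prod (isCompact_uIcc (a := (0 : ℝ)) (b := 2 * Real.pi)))).mono_set
      (Set.prod_mono Set.uIoc_subset_uIcc Set.uIoc_subset_uIcc)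

/-- The positive part of `t` is `(|t| + t) / 2`, and the linear part integrates to zero over both
angles, so half of 32 remains. -/
lemma integral_integral_max_cos_sub_cos :
    ∫ φ in (0 : ℝ)..(2 * Real.pi), ∫ α in (-Real.pi)..Real.pi,
      max (Real.cos α - Real.cos φ) 0 = 16 := by
  have h1 : ∀ φ : ℝ, ∫ α in (-Real.pi)..Real.pi, max (Real.cos α - Real.cos φ) 0 =
      1 / 2 * (∫ α in (-Real.pi)..Real.pi, |Real.cos α - Real.cos φ|) -
        Real.pi * Real.cos φ := by
    intro φ
    have h2 : ∀ α, max (Real.cos α - Real.cos φ) 0 =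
        1 / 2 * |Real.cos α - Real.cos φ| + 1 / 2 * (Real.cos α - Real.cos φ) := by
      intro α
      rcases max_cases (Real.cos α - Real.cos φ) 0 with h | h
      · rw [h.1, abs_of_nonneg h.2]; ring
      · rw [h.1, abs_of_neg h.2]; ring
    simp_rw [h2]
    rw [intervalIntegral.integral_add (Continuous.intervalIntegrable (by fun_prop) _ _)
      (Continuous.intervalIntegrable (by fun_prop) _ _), intervalIntegral.integral_const_mul,
      intervalIntegral.integral_const_mul, intervalIntegral.integral_sub
      (Continuous.intervalIntegrable (by fun_prop) _ _) (by simp), integral_cos,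
      intervalIntegral.integral_const]
    simp
    ring
  simp_rw [h1]
  rw [intervalIntegral.integral_sub, intervalIntegral.integral_const_mul,
    integral_integral_abs_cos_sub_cos, intervalIntegral.integral_const_mul, integral_cos]
  · simp
    norm_num
  · refine Continuous.intervalIntegrable (continuous_const.mul ?_) _ _
    exact intervalIntegral.continuous_parametric_intervalIntegral_of_continuous' (by fun_prop) _ _
  · exact Continuous.intervalIntegrable (by fun_prop) _ _

lemma integral_max_cos_sub_cos_shift (θ β : ℝ) :
    ∫ α in (-Real.pi)..Real.pi, max (Real.cos (θ - α) - Real.cos (θ - β)) 0 =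
      ∫ α in (-Real.pi)..Real.pi, max (Real.cos α - Real.cos (θ - β)) 0 := by
  have hper : Function.Periodic (fun α : ℝ => max (Real.cos α - Real.cos (θ - β)) 0)
    (2 * Real.pi) := fun α => by simp
  rw [intervalIntegral.integral_comp_sub_left
    (fun α : ℝ => max (Real.cos α - Real.cos (θ - β)) 0)]
  have h := hper.intervalIntegral_add_eq (θ - Real.pi) (-Real.pi)
  rw [show -Real.pi + 2 * Real.pi = Real.pi by ring] at h
  rw [← h]
  congr 1
  ring

lemma integral_integral_max_cos_sub_cos_shift (β : ℝ) :
    ∫ θ in (0 : ℝ)..(2 * Real.pi), ∫ α in (-Real.pi)..Real.pi,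
      max (Real.cos (θ - α) - Real.cos (θ - β)) 0 = 16 := by
  simp_rw [integral_max_cos_sub_cos_shift]
  rw [intervalIntegral.integral_comp_sub_right
    (fun φ : ℝ => ∫ α in (-Real.pi)..Real.pi, max (Real.cos α - Real.cos φ) 0)]
  have hper : Function.Periodic
    (fun φ : ℝ => ∫ α in (-Real.pi)..Real.pi, max (Real.cos α - Real.cos φ) 0)
    (2 * Real.pi) := fun φ => by simp
  have h := hper.intervalIntegral_add_eq (0 - β) 0
  rw [zero_add, integral_integral_max_cos_sub_cos] at h
  rw [← h]
  congr 1
  ring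

end TrigonometricIntegral

/-! ### Averaging the exponential over the circle, with a uniform quadratic error. -/

section Expansion

lemma abs_one_sub_exp_neg_sub_le {t : ℝ} (ht : 0 ≤ t) : |1 - Real.exp (-t) - t| ≤ t ^ 2 := by
  have h1 := Real.add_one_le_exp (-t)
  rw [abs_le]
  refine ⟨?_, by nlinarith [sq_nonneg t]⟩
  have h2 : Real.exp (-t) ≤ 1 / (1 + t) := by
    rw [Real.exp_neg, ← one_div]
    exact one_div_le_one_div_of_le (by linarith) (by linarith [Real.add_one_le_exp t])
  have h3 : 1 / (1 + t) ≤ 1 - t + t ^ 2 := by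
    -- `(1 - t + t²)(1 + t) = 1 + t³`.
    rw [div_le_iff₀ (by linarith)]
    have : 0 ≤ t ^ 3 := by positivity
    linarith
  linarith

lemma abs_integral_max_cos_le (θ β : ℝ) :
    |∫ α in (-Real.pi)..Real.pi, max (Real.cos (θ - α) - Real.cos (θ - β)) 0| ≤
      4 * Real.pi := by
  have h := intervalIntegral.norm_integral_le_of_norm_le_const (a := -Real.pi) (b := Real.pi)
    (f := fun α => max (Real.cos (θ - α) - Real.cos (θ - β)) 0) (C := 2) fun α _ => by
      rw [Real.norm_of_nonneg (le_max_right _ _)]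
      exact max_le (by linarith [Real.cos_le_one (θ - α), Real.neg_one_le_cos (θ - β)]) zero_le_two
  rw [Real.norm_eq_abs] at h
  refine h.trans_eq ?_
  rw [sub_neg_eq_add, abs_of_pos (by linarith [Real.pi_pos])]
  ring

lemma intervalIntegrable_exp_luneArea (lam : ℝ≥0) (xs : Plane) (r : ℝ) :
    IntervalIntegrable (fun θ => Real.exp (-(lam * luneArea xs (polarPoint r θ)))) volume 0
      (2 * Real.pi) := by
  have hm : Measurable fun θ => Real.exp (-(lam * luneArea xs (polarPoint r θ))) := by
    have h : Measurable fun θ => luneArea xs (polarPoint r θ) :=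
      (measurable_luneArea xs).comp (continuous_polarPoint.comp (by fun_prop :
        Continuous fun θ : ℝ => (r, θ))).measurable
    exact Real.measurable_exp.comp (h.const_mul _).neg
  refine (intervalIntegrable_const (c := (1 : ℝ))).mono_fun hm.aestronglyMeasurable ?_
  refine Eventually.of_forall fun θ => ?_
  simp only [Real.norm_eq_abs, Real.abs_exp, abs_one]
  exact Real.exp_le_one_iff.2 (neg_nonpos.2 (mul_nonneg lam.2 (luneArea_nonneg _ _)))

lemma abs_one_sub_exp_luneArea_le {R r : ℝ} (lam : ℝ≥0) (hR : 0 < R) (hr : 0 ≤ r)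
    (hrR : r ≤ R / 2) (β θ : ℝ) :
    |1 - Real.exp (-(lam * luneArea (polarPoint R β) (polarPoint r θ))) -
      lam * (R * r * ∫ α in (-Real.pi)..Real.pi,
        max (Real.cos (θ - α) - Real.cos (θ - β)) 0)| ≤
      ((lam * (8 * Real.pi * R)) ^ 2 + lam * (8 * Real.pi)) * r ^ 2 := by
  have h1 := abs_luneArea_sub_le hR hr hrR β θ
  set f := luneArea (polarPoint R β) (polarPoint r θ)
  set I := ∫ α in (-Real.pi)..Real.pi, max (Real.cos (θ - α) - Real.cos (θ - β)) 0
  have hf0 : 0 ≤ f := luneArea_nonneg _ _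
  have hI : I ≤ 4 * Real.pi := (abs_le.1 (abs_integral_max_cos_le θ β)).2
  have hl : (0 : ℝ) ≤ lam := lam.2
  -- The main term is at most `4πRr`, and `r ≤ R / 2` bounds the error `8πr²` by the same amount.
  have h2 : f ≤ 8 * Real.pi * R * r := by
    have h3 := (abs_le.1 h1).2
    have h4 : R * r * I ≤ R * r * (4 * Real.pi) := mul_le_mul_of_nonneg_left hI (by positivity)
    have h5 : 8 * Real.pi * r * r ≤ 8 * Real.pi * r * (R / 2) :=
      mul_le_mul_of_nonneg_left hrR (by have := Real.pi_pos; positivity)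
    linarith
  have h3 := abs_one_sub_exp_neg_sub_le (mul_nonneg hl hf0)
  have h4 : (lam * f) ^ 2 ≤ (lam * (8 * Real.pi * R)) ^ 2 * r ^ 2 := by
    rw [← mul_pow]
    refine pow_le_pow_left₀ (mul_nonneg hl hf0) ?_ 2
    rw [mul_assoc (lam : ℝ)]
    gcongr
  calc _ = |(1 - Real.exp (-(lam * f)) - lam * f) + lam * (f - R * r * I)| := by congr 1; ring
    _ ≤ |1 - Real.exp (-(lam * f)) - lam * f| + |lam * (f - R * r * I)| := abs_add_le _ _
    _ ≤ (lam * (8 * Real.pi * R)) ^ 2 * r ^ 2 + lam * (8 * Real.pi * r ^ 2) := by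
        rw [abs_mul, abs_of_nonneg hl]
        gcongr
        exact h3.trans h4
    _ = _ := by ring

lemma abs_average_sub_le {R r : ℝ} (lam : ℝ≥0) (hR : 0 < R) (hr : 0 ≤ r)
    (hrR : r ≤ R / 2) (β : ℝ) :
    |1 - 1 / (2 * Real.pi) * (∫ θ in (0 : ℝ)..(2 * Real.pi),
        Real.exp (-(lam * luneArea (polarPoint R β) (polarPoint r θ)))) -
      lam * (8 / Real.pi) * R * r| ≤
      ((lam * (8 * Real.pi * R)) ^ 2 + lam * (8 * Real.pi)) * r ^ 2 := by
  have hpi := Real.pi_pos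
  set e : ℝ → ℝ := fun θ => Real.exp (-(lam * luneArea (polarPoint R β) (polarPoint r θ))) with he
  set I : ℝ → ℝ := fun θ => ∫ α in (-Real.pi)..Real.pi,
    max (Real.cos (θ - α) - Real.cos (θ - β)) 0 with hIdef
  have hei : IntervalIntegrable e volume 0 (2 * Real.pi) :=
    intervalIntegrable_exp_luneArea lam _ r
  have hI : Continuous I :=
    intervalIntegral.continuous_parametric_intervalIntegral_of_continuous' (by fun_prop) _ _
  have hIi : IntervalIntegrable (fun θ => lam * (R * r * I θ)) volume 0 (2 * Real.pi) :=
    Continuous.intervalIntegrable (by fun_prop) _ _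
  have hbound := intervalIntegral.norm_integral_le_of_norm_le_const (a := 0) (b := 2 * Real.pi)
    (f := fun θ => 1 - e θ - lam * (R * r * I θ)) fun θ _ =>
      abs_one_sub_exp_luneArea_le lam hR hr hrR β θ
  have hint : ∫ θ in (0 : ℝ)..(2 * Real.pi), (1 - e θ - lam * (R * r * I θ)) =
      2 * Real.pi - (∫ θ in (0 : ℝ)..(2 * Real.pi), e θ) - lam * (R * r * 16) := by
    rw [intervalIntegral.integral_sub (intervalIntegrable_const.sub hei) hIi,
      intervalIntegral.integral_sub intervalIntegrable_const hei,
      intervalIntegral.integral_const_mul, intervalIntegral.integral_const_mul,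
      integral_integral_max_cos_sub_cos_shift, intervalIntegral.integral_const]
    simp
  rw [hint, sub_zero, abs_of_pos (by positivity : 0 < 2 * Real.pi), Real.norm_eq_abs] at hbound
  have heq : 1 - 1 / (2 * Real.pi) * (∫ θ in (0 : ℝ)..(2 * Real.pi), e θ) -
      lam * (8 / Real.pi) * R * r = (2 * Real.pi - (∫ θ in (0 : ℝ)..(2 * Real.pi), e θ) -
        lam * (R * r * 16)) / (2 * Real.pi) := by
    field_simp
    ring
  rw [heq, abs_div, abs_of_pos (by positivity : 0 < 2 * Real.pi), div_le_iff₀ (by positivity)]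
  exact hbound

end Expansion

theorem proposition5 {Ω : Type*} [MeasurableSpace Ω] (P : Measure Ω) [IsProbabilityMeasure P]
    (lamA : ℝ≥0) (hlamA : 0 < lamA) (lamU : ℝ) (hlamU : 0 < lamU)
    (Φ : Ω → Set Plane) (hΦ : IsHomogeneousPPP P Φ lamA)
    (X : Ω → Plane) (hXmeas : Measurable X) (hX : ∀ᵐ ω ∂P, IsNearestPoint (Φ ω) (X ω))
    (xs : Plane) (hxs : xs ≠ 0) :
    (∀ x : Plane, Tendsto (approxCellProb P Φ X xs x) (𝓝[>] (0 : ℝ))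
      (𝓝 (cellProb P Φ X xs x))) ∧
    (∀ r : ℝ, 0 ≤ r → IntervalIntegrable
      (fun θ => cellProb P Φ X xs (polarPoint r θ + 0)) volume 0 (2 * Real.pi)) ∧
    (fun r : ℝ => equivalentDensity P Φ X lamU xs 0 r
      - lamU * (lamA : ℝ) * (8 / Real.pi) * ‖xs‖ * r) =O[𝓝[>] (0 : ℝ)] (fun r : ℝ => r ^ 2) ∧
    Tendsto (fun r : ℝ => equivalentDensity P Φ X lamU xs 0 r / r) (𝓝[>] (0 : ℝ))
      (𝓝 (lamU * (lamA : ℝ) * (8 / Real.pi) * ‖xs‖)) := by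
  have hcell := cellProb_eq hlamA hΦ hXmeas hX xs
  have hR : 0 < ‖xs‖ := norm_pos_iff.2 hxs
  have hO : (fun r : ℝ => equivalentDensity P Φ X lamU xs 0 r
      - lamU * (lamA : ℝ) * (8 / Real.pi) * ‖xs‖ * r) =O[𝓝[>] (0 : ℝ)] (fun r : ℝ => r ^ 2) := by
    -- The angle of `xs` enters neither the slope nor the error constant.
    obtain ⟨β, hβ⟩ := exists_polarPoint_eq xs
    refine IsBigO.of_bound (lamU * ((lamA * (8 * Real.pi * ‖xs‖)) ^ 2 + lamA * (8 * Real.pi))) ?_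
    filter_upwards [Ioc_mem_nhdsGT (half_pos hR)] with r hr
    have h := abs_average_sub_le lamA hR hr.1.le hr.2 β
    rw [hβ] at h
    simp only [equivalentDensity, add_zero, hcell]
    rw [Real.norm_eq_abs, Real.norm_of_nonneg (sq_nonneg r), mul_assoc lamU (_ + _)]
    refine le_trans (le_of_eq ?_) (mul_le_mul_of_nonneg_left h hlamU.le)
    rw [← abs_of_pos hlamU, ← abs_mul, abs_of_pos hlamU]
    congr 1
    ring
  refine ⟨fun x => ?_, fun r _ => ?_, hO, ?_⟩
  · rw [hcell]
    exact tendsto_approxCellProb hlamA hΦ hXmeas hX xs x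
  · simp only [add_zero, hcell]
    exact intervalIntegrable_exp_luneArea lamA xs r
  · have hlin : (fun r : ℝ => r ^ 2) =o[𝓝[>] (0 : ℝ)] fun r : ℝ => r :=
      ((isLittleO_pow_id one_lt_two).mono nhdsWithin_le_nhds)
    have ho := (hO.trans_isLittleO hlin).tendsto_div_nhds_zero
    have h := ho.add_const (lamU * (lamA : ℝ) * (8 / Real.pi) * ‖xs‖)
    rw [zero_add] at h
    refine h.congr' ?_
    filter_upwards [self_mem_nhdsWithin] with r (hr : 0 < r)
    have hr' := hr.ne'
    field_simp
    ring
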